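/- **Setting.** A semilattice is a meet-semilattice with top; $\mathbf{SL}$ ($=\mathbf{MF}$, M-frames) is the category of semilattices and maps preserving finite meets. An implicative semilattice has in addition an operation $\to$ with $a\le b\to c$ iff $a\wedge b\le c$; $\mathbf{ISL}$ is the category of implicative semilattices and maps preserving $\top,\wedge,\to$. $\mathbf{IF}$ (I-frames) has implicative semilattices as objects, and as morphisms the maps $f$ preserving finite meets that are bounded: if $f(x)\le y'$ then $f(y)=y'$ for some $y\ge x$. Let $i:\mathbf{IF}\to\mathbf{MF}$ and $j:\mathbf{ISL}\to\mathbf{SL}$ be the inclusions. For a semilattice $A$, $\mathsf FA$ is the semilattice of filters (up-closed subsets containing $\top$ and closed under $\wedge$) ordered by inclusion; $\mathsf F$ is a contravariant functor by inverse images, it restricts to $\mathsf F_1:\mathbf{IF}^{op}\to\mathbf{ISL}$ and $\mathsf F_2:\mathbf{ISL}^{op}\to\mathbf{IF}$, and $\eta_A:A\to\mathsf{FF}A$, $a\mapsto\tilde a=\{p\mid a\in p\}$. A filter of $\mathsf FA$ is *clopen* if it is of the form $\tilde a$, and *closed* if it is the intersection of the clopen filters containing it. For an I-frame $X$ let $\mathsf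 HX$ be the set of up-closed collections $W\subseteq\mathsf FX$, ordered by inclusion, and for $f:X\to X'$ let $\mathsf Hf(W)=\{a'\in\mathsf FX'\mid f^{-1}(a')\in W\}$; this gives $\mathsf H:\mathbf{IF}\to\mathbf{MF}$. Let $\mathsf M:\mathbf{ISL}\to\mathbf{SL}$ send $A$ to the free semilattice generated by $\{\vartriangle a\mid a\in A\}$ modulo $\vartriangle(a\wedge b)\le\vartriangle a$, with $\mathsf Mh(\vartriangle a)=\vartriangle h(a)$. Let $\rho:\mathsf M\circ\mathsf F_1\to\mathsf F\circ\mathsf H$ be given by $\rho_X(\vartriangle a)=\{W\in\mathsf HX\mid a\in W\}$, and let $\rho^\flat:\mathsf{HF}_2\to\mathsf{FM}$ be the composite $$\mathsf{HF}_2A\xrightarrow{\eta}\mathsf{FFHF}_2A\xrightarrow{\mathsf F\rho_{\mathsf F_2A}}\mathsf{FMF}_1\mathsf F_2A\xrightarrow{\mathsf{FM}\eta_A}\mathsf{FM}A.$$ For functors $G,T$ from $\mathbf C$ to $\mathbf D$, a $(G,T)$-dialgebra is an object $X$ with a morphism $\gamma:GX\to TX$; a morphism $(X,\gamma)\to(X',\gamma')$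 is $f:X\to X'$ with $Tf\circ\gamma=\gamma'\circ Gf$. The complex algebra of an $(i,\mathsf H)$-dialgebra $(X,\gamma)$ is the $(\mathsf M,j)$-dialgebra $(\mathsf F_1X,\gamma^*)$ with $\gamma^*=\mathsf F\gamma\circ\rho_X$. Formulas are built from $\top$ by $\wedge,\to,\vartriangle$ (without proposition letters). In $(X,\gamma)$: $x\Vdash\top$ always; $x\Vdash\varphi\wedge\psi$ iff $x\Vdash\varphi$ and $x\Vdash\psi$; $x\Vdash\varphi\to\psi$ iff every $y\ge x$ with $y\Vdash\varphi$ has $y\Vdash\psi$; $x\Vdash\vartriangle\varphi$ iff $\{y\mid y\Vdash\varphi\}\in\gamma(x)$. $\mathbf{MI}_\vartriangle$ is the Hilbert system with axioms $\varphi\to(\psi\to\varphi)$, $(\varphi\to(\psi\to\chi))\to((\varphi\to\psi)\to(\varphi\to\chi))$, $\varphi\wedge\psi\to\varphi$, $\varphi\wedge\psi\to\psi$, $\varphi\to(\psi\to\varphi\wedge\psi)$, $\top$, $\vartriangle(\varphi\wedge\psi)\to\vartriangle\varphi$, modus ponens, and the rule from $\varphi\leftrightarrow\psi$ infer $\vartriangle\varphi\leftrightarrow\vartriangle\psi$.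 For an initial $(\mathsf M,j)$-dialgebra $(\Psi,\ell)$, let $[\![\cdot]\!]_\gamma:\Psi\to\mathsf F_1X$ be the unique $(\mathsf M,j)$-dialgebra morphism to the complex algebra of $(X,\gamma)$, and let the theory map be $\mathrm{th}_\gamma=\mathsf F_2[\![\cdot]\!]_\gamma\circ\eta_X:iX\to i\mathsf F_2\Psi$. $(X,\gamma)$ is *expressive* if $\mathrm{th}_\gamma$ is an $(i,\mathsf H)$-dialgebra morphism out of $(X,\gamma)$ followed by a monomorphism of $\mathbf{IF}$, and *expressive-somewhere-else* if $\mathrm{th}_\gamma$ is a morphism of $\mathbf{MF}$ followed by the theory map of an expressive dialgebra. **Theorem.** 1. For every implicative semilattice $A$ there is an $\mathbf{MF}$-morphism $\tau_A:\mathsf{FM}A\to\mathsf{HF}_2A$ such that for $U\in\mathsf{FM}A$: $\tilde a\in\tau_A(U)$ iff $\vartriangle a\in U$; a closed filter is in $\tau_A(U)$ iff all clopen filters containing it are; and a filter is in $\tau_A(U)$ iff it contains a closed filter that is in $\tau_A(U)$. The $\tau_A$ form a natural transformation $\tau:\mathsf{FM}\to\mathsf{HF}_2$ with $\rho^\flat\circ\tau=\mathrm{id}$.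 2. (Completeness) The Lindenbaum-Tarski algebra (formulas modulo provable equivalence, with $\ell(\vartriangle[\varphi])=[\vartriangle\varphi]$) is an initial $(\mathsf M,j)$-dialgebra, and $[\![[\varphi]]\!]_\gamma=\{x\mid x\Vdash\varphi\}$. For every initial $(\mathsf M,j)$-dialgebra $\Psi$ the source $([\![\cdot]\!]_\gamma:\Psi\to\mathsf F_1X)_{(X,\gamma)}$, indexed by all $(i,\mathsf H)$-dialgebras, is jointly monic. A formula is a theorem of $\mathbf{MI}_\vartriangle$ iff it is satisfied at all states of all $(i,\mathsf H)$-dialgebras. 3. (Filter extensions) For an $(i,\mathsf H)$-dialgebra $(X,\gamma)$ let its filter extension be $(\hat X,\hat\gamma)$ with $\hat X=\mathsf F_2\mathsf F_1X$ and $\hat\gamma=\tau_{\mathsf F_1X}\circ\mathsf F\gamma^*$. Then for $p\in\hat X$: $\tilde a\in\hat\gamma(p)$ iff $\{x\mid a\in\gamma(x)\}\in p$; a closed filter is in $\hat\gamma(p)$ iff all clopen filters containing it are; a filter is in $\hat\gamma(p)$ iff it contains a closed filter that is in $\hat\gamma(p)$. 4. (Expressivity-somewhere-else) $(\hat X,\hat\gamma)$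 is expressive and $\mathrm{th}_\gamma=\mathrm{th}_{\hat\gamma}\circ\eta_X$; hence $(X,\gamma)$ is expressive-somewhere-else. Two states $x,y$ of $(X,\gamma)$ satisfy the same formulas if and only if $\eta_X(x)$ and $\eta_X(y)$ are behaviourally equivalent in $(\hat X,\hat\gamma)$, that is, $f(\eta_X(x))=f(\eta_X(y))$ for some $(i,\mathsf H)$-dialgebra morphism $f$ out of $(\hat X,\hat\gamma)$. -/

import Mathlib

open CategoryTheory Opposite

universe u v w

namespace MonMI

/-! ### Filters of a meet-semilattice with top, and the contravariant functor `F` -/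

section Filters

variable {A B C : Type*} [SemilatticeInf A] [OrderTop A] [SemilatticeInf B] [OrderTop B]
  [SemilatticeInf C] [OrderTop C]

/-- A subset containing `⊤`, closed under binary meets and up-closed, as a filter. -/
def mkFilter (s : Set A) (htop : ⊤ ∈ s) (hinf : ∀ x ∈ s, ∀ y ∈ s, x ⊓ y ∈ s)
    (hup : ∀ x y, x ≤ y → x ∈ s → y ∈ s) : Order.PFilter A :=
  (Order.IsPFilter.of_def (F := s) ⟨⊤, htop⟩
    (fun x hx y hy => ⟨x ⊓ y, hinf x hx y hy, inf_le_left, inf_le_right⟩)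
    (fun {x y} h hx => hup x y h hx)).toPFilter

theorem mem_mkFilter {s : Set A} {h1 h2 h3} {x : A} : x ∈ mkFilter s h1 h2 h3 ↔ x ∈ s := Iff.rfl

/-- Filters ordered by inclusion form a meet-semilattice, the meet being the intersection. -/
instance filterInf : SemilatticeInf (Order.PFilter A) :=
  { (inferInstance : PartialOrder (Order.PFilter A)) with
    inf := fun p q => mkFilter {x | x ∈ p ∧ x ∈ q}
      ⟨Order.PFilter.top_mem, Order.PFilter.top_mem⟩
      (fun _ hx _ hy => ⟨Order.PFilter.inf_mem hx.1 hy.1, Order.PFilter.inf_mem hx.2 hy.2⟩)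
      (fun _ _ h hx => ⟨Order.PFilter.mem_of_le h hx.1, Order.PFilter.mem_of_le h hx.2⟩)
    inf_le_left := fun _ _ _ hx => hx.1
    inf_le_right := fun _ _ _ hx => hx.2
    le_inf := fun _ _ _ h1 h2 _ hx => ⟨h1 hx, h2 hx⟩ }

/-- The whole semilattice is the greatest filter. -/
instance filterTop : OrderTop (Order.PFilter A) where
  top := mkFilter Set.univ trivial (fun _ _ _ _ => trivial) (fun _ _ _ _ => trivial)
  le_top := fun _ _ _ => trivial

theorem mem_inf_filter {p q : Order.PFilter A} {x : A} : x ∈ p ⊓ q ↔ x ∈ p ∧ x ∈ q := Iff.rfl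

theorem mem_top_filter {x : A} : x ∈ (⊤ : Order.PFilter A) := trivial

/-- Inverse image of filters along a semilattice morphism. -/
def filterComap (f : InfTopHom A B) : InfTopHom (Order.PFilter B) (Order.PFilter A) where
  toFun q := mkFilter {a | f a ∈ q}
    (by simp [Order.PFilter.top_mem])
    (fun x hx y hy => by
      simp only [Set.mem_ofPred_eq, map_inf]
      exact Order.PFilter.inf_mem hx hy)
    (fun x y h hx => Order.PFilter.mem_of_le (OrderHomClass.mono f h) hx)
  map_inf' _ _ := rfl
  map_top' := rfl

theorem mem_filterComap {f : InfTopHom A B} {q : Order.PFilter B} {a : A} :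
    a ∈ filterComap f q ↔ f a ∈ q := Iff.rfl

/-- The map `a ↦ ã = {p | a ∈ p}`. -/
def tilde : InfTopHom A (Order.PFilter (Order.PFilter A)) where
  toFun a := mkFilter {p | a ∈ p} (mem_top_filter (x := a)) (fun _ hp _ hq => ⟨hp, hq⟩)
    (fun _ _ h hp => h hp)
  map_inf' a b := by
    apply SetLike.ext
    intro p
    exact ⟨fun h => ⟨Order.PFilter.mem_of_le (F := p) inf_le_left h, Order.PFilter.mem_of_le (F := p) inf_le_right h⟩,
      fun h => Order.PFilter.inf_mem h.1 h.2⟩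
  map_top' := by
    apply SetLike.ext
    intro p
    exact iff_of_true Order.PFilter.top_mem trivial

theorem mem_tilde {a : A} {p : Order.PFilter A} : p ∈ tilde a ↔ a ∈ p := Iff.rfl

/-- Filters of `F A` of the form `ã`. -/
def IsClopenFilter (c : Order.PFilter (Order.PFilter A)) : Prop := ∃ a : A, c = tilde a

/-- Filters of `F A` that are the intersection of all clopen filters in which they are
contained. -/
def IsClosedFilter (c : Order.PFilter (Order.PFilter A)) : Prop :=
  (c : Set (Order.PFilter A)) =
    ⋂ d ∈ {d : Order.PFilter (Order.PFilter A) | IsClopenFilter d ∧ c ≤ d},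
      (d : Set (Order.PFilter A))

theorem isClosedFilter_iff {c : Order.PFilter (Order.PFilter A)} :
    IsClosedFilter c ↔ ∃ q : Order.PFilter A, c = Order.PFilter.principal q := by
  constructor
  · intro hc
    let q : Order.PFilter A := mkFilter {a | c ≤ tilde a}
      (fun _ _ => Order.PFilter.top_mem)
      (fun _ hx _ hy _ hp => Order.PFilter.inf_mem (hx hp) (hy hp))
      (fun _ _ h hx p hp => Order.PFilter.mem_of_le (F := p) h (hx hp))
    refine ⟨q, ?_⟩
    apply SetLike.ext
    intro p
    constructor
    · intro hp a ha
      exact ha hp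
    · intro hp
      have hq : q ∈ (c : Set (Order.PFilter A)) := by
        rw [hc]
        simp only [Set.mem_ofPred_eq, Set.mem_iInter, and_imp]
        rintro d ⟨a, rfl⟩ hd
        exact hd
      exact Order.PFilter.mem_of_le (F := c) hp hq
  · rintro ⟨q, rfl⟩
    ext p
    simp only [Set.mem_ofPred_eq, Set.mem_iInter, and_imp]
    constructor
    · intro hp d _ hd
      exact hd hp
    · intro hp a ha
      exact hp (tilde a) ⟨a, rfl⟩ (fun r hr => hr ha)

end Filters

/-- The contravariant filter functor `F : SL → SL`, with `F f` the inverse image. M-frames are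
meet-semilattices with top, so that `MF` is `SemilatInfCat` as well. -/
def F : SemilatInfCat.{u}ᵒᵖ ⥤ SemilatInfCat.{u} where
  obj A := SemilatInfCat.of (Order.PFilter A.unop)
  map f := filterComap f.unop
  map_id _ := rfl
  map_comp _ _ := rfl

/-- The unit `η_A : A → F F A`, `a ↦ ã`, of the dual adjunction of `F` with itself. -/
def eta : 𝟭 SemilatInfCat.{u} ⟶ F.rightOp ⋙ F where
  app A := (tilde : InfTopHom A (Order.PFilter (Order.PFilter A)))
  naturality _ _ _ := rfl

/-! ### Implicative semilattices, I-frames -/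

/-- Implicative semilattices: meet-semilattices with top and relative pseudocomplements. -/
class ImpSemilattice (A : Type u) extends SemilatticeInf A, OrderTop A, HImp A where
  /-- residuation -/
  le_himp_iff' : ∀ a b c : A, a ≤ b ⇨ c ↔ a ⊓ b ≤ c

section Imp

variable {A B : Type*} [ImpSemilattice A] [ImpSemilattice B]

theorem le_imp_iff {a b c : A} : a ≤ b ⇨ c ↔ a ⊓ b ≤ c := ImpSemilattice.le_himp_iff' a b c

/-- The implication `{x | ∀ y ≥ x, y ∈ a → y ∈ b}` of two filters. -/
def filterImp (a b : Order.PFilter A) : Order.PFilter A :=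
  mkFilter {x | ∀ y, x ≤ y → y ∈ a → y ∈ b}
    (fun y hy _ => by
      rw [top_le_iff.1 hy]
      exact Order.PFilter.top_mem)
    (fun x hx y hy z hz hza => by
      have h1 : z ≤ y ⇨ z := le_imp_iff.2 inf_le_left
      have h2 : z ≤ (y ⇨ z) ⇨ z := le_imp_iff.2 inf_le_left
      have h3 : y ⇨ z ∈ b := hx _ (le_imp_iff.2 hz) (Order.PFilter.mem_of_le h1 hza)
      have h4 : (y ⇨ z) ⇨ z ∈ b :=
        hy _ (le_imp_iff.2 (by rw [inf_comm]; exact le_imp_iff.1 le_rfl))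
          (Order.PFilter.mem_of_le h2 hza)
      exact Order.PFilter.mem_of_le (le_imp_iff.1 le_rfl) (Order.PFilter.inf_mem h4 h3))
    (fun _ _ h hx z hz => hx z (h.trans hz))

/-- The filters of an implicative semilattice form an implicative semilattice. -/
instance filterImpSemilattice : ImpSemilattice (Order.PFilter A) :=
  { filterInf, filterTop with
    himp := filterImp
    le_himp_iff' := fun p q r => by
      constructor
      · rintro h x ⟨hp, hq⟩
        exact h hp x le_rfl hq
      · intro h x hx y hy hq
        exact h ⟨Order.PFilter.mem_of_le hy hx, hq⟩ }

theorem mem_himp_filter {a b : Order.PFilter A} {x : A} :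
    x ∈ a ⇨ b ↔ ∀ y, x ≤ y → y ∈ a → y ∈ b := Iff.rfl

end Imp

/-- Objects of the category `ISL` of implicative semilattices. -/
structure ISL : Type (u + 1) where
  /-- the underlying type -/
  carrier : Type u
  [str : ImpSemilattice carrier]

instance : CoeSort ISL.{u} (Type u) := ⟨ISL.carrier⟩
attribute [instance] ISL.str

/-- Homomorphisms of implicative semilattices preserve top, meets and implications. -/
@[ext]
structure ISLHom (A B : ISL.{u}) where
  /-- the underlying semilattice morphism -/
  hom : InfTopHom A B
  map_himp : ∀ a b : A, hom (a ⇨ b) = hom a ⇨ hom b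

instance : Category ISL.{u} where
  Hom A B := ISLHom A B
  id A := ⟨InfTopHom.id A, fun _ _ => rfl⟩
  comp f g := ⟨g.hom.comp f.hom, fun a b => by
    simp only [InfTopHom.comp_apply]
    rw [f.map_himp, g.map_himp]⟩

/-- I-frames: implicative semilattices regarded as intuitionistic Kripke frames. -/
structure IF : Type (u + 1) where
  /-- the underlying type -/
  carrier : Type u
  [str : ImpSemilattice carrier]

instance : CoeSort IF.{u} (Type u) := ⟨IF.carrier⟩
attribute [instance] IF.str

/-- I-frame morphisms: bounded maps that preserve finite meets. -/
@[ext]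
structure IFHom (X Y : IF.{u}) where
  /-- the underlying semilattice morphism -/
  hom : InfTopHom X Y
  bounded : ∀ (x : X) (y' : Y), hom x ≤ y' → ∃ y : X, x ≤ y ∧ hom y = y'

instance : Category IF.{u} where
  Hom X Y := IFHom X Y
  id X := ⟨InfTopHom.id X, fun _ y h => ⟨y, h, rfl⟩⟩
  comp f g := ⟨g.hom.comp f.hom, fun x z h => by
    obtain ⟨y, hy, rfl⟩ := g.bounded (f.hom x) z h
    obtain ⟨t, ht, rfl⟩ := f.bounded x y hy
    exact ⟨t, ht, rfl⟩⟩

/-- The inclusion functor `i : IF → MF`. -/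
def i : IF.{u} ⥤ SemilatInfCat.{u} where
  obj X := SemilatInfCat.of X
  map f := f.hom
  map_id _ := rfl
  map_comp _ _ := rfl

/-- The inclusion functor `j : ISL → SL`. -/
def j : ISL.{u} ⥤ SemilatInfCat.{u} where
  obj A := SemilatInfCat.of A
  map f := f.hom
  map_id _ := rfl
  map_comp _ _ := rfl

/-- The restriction `F₁ : IF → ISL` of the contravariant filter functor. -/
def F1 : IF.{u}ᵒᵖ ⥤ ISL.{u} where
  obj X := ⟨Order.PFilter X.unop⟩
  map {X Y} f := ⟨filterComap f.unop.hom, fun a b => by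
    apply SetLike.ext
    intro x
    constructor
    · intro h y hy hya
      exact h _ (OrderHomClass.mono f.unop.hom hy) hya
    · intro h y' hy' hya
      obtain ⟨y, hy, rfl⟩ := f.unop.bounded x y' hy'
      exact h y hy hya⟩
  map_id _ := rfl
  map_comp _ _ := rfl

/-- The restriction `F₂ : ISL → IF` of the contravariant filter functor. -/
def F2 : ISL.{u}ᵒᵖ ⥤ IF.{u} where
  obj A := ⟨Order.PFilter A.unop⟩
  map {A B} f := ⟨filterComap f.unop.hom, fun q p hqp => by
    refine ⟨mkFilter {b | ∃ d ∈ q, ∃ a ∈ p, d ⊓ f.unop.hom a ≤ b}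
      ⟨⊤, Order.PFilter.top_mem, ⊤, Order.PFilter.top_mem, le_top⟩ ?_ ?_, ?_, ?_⟩
    · rintro x ⟨d, hd, a, ha, h⟩ y ⟨d', hd', a', ha', h'⟩
      refine ⟨d ⊓ d', Order.PFilter.inf_mem hd hd', a ⊓ a', Order.PFilter.inf_mem ha ha', ?_⟩
      rw [map_inf, inf_inf_inf_comm]
      exact inf_le_inf h h'
    · rintro x y hxy ⟨d, hd, a, ha, h⟩
      exact ⟨d, hd, a, ha, h.trans hxy⟩
    · intro d hd
      exact ⟨d, hd, ⊤, Order.PFilter.top_mem, inf_le_left⟩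
    · apply SetLike.ext
      intro c
      constructor
      · rintro ⟨d, hd, a, ha, h⟩
        have h1 : d ≤ f.unop.hom (a ⇨ c) := by
          rw [f.unop.map_himp]
          exact le_imp_iff.2 h
        have h2 : a ⇨ c ∈ p := hqp (Order.PFilter.mem_of_le (F := q) h1 hd)
        exact Order.PFilter.mem_of_le (le_imp_iff.1 le_rfl) (Order.PFilter.inf_mem h2 ha)
      · intro hc
        exact ⟨⊤, Order.PFilter.top_mem, c, hc, inf_le_right⟩⟩
  map_id _ := rfl
  map_comp _ _ := rfl

/-- The unit `η_A : A → F₁ F₂ A`, `a ↦ ã`, in the category `ISL`. -/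
def etaISL : 𝟭 ISL.{u} ⟶ F2.rightOp ⋙ F1 where
  app A := ⟨(tilde : InfTopHom A (Order.PFilter (Order.PFilter A))), fun a b => by
    apply SetLike.ext (A := Order.PFilter (Order.PFilter A))
    intro p
    constructor
    · intro h q hq hqa
      exact Order.PFilter.mem_of_le (F := q) (le_imp_iff.1 le_rfl)
        (Order.PFilter.inf_mem (F := q) (hq h) hqa)
    · intro h
      let q : Order.PFilter A := mkFilter {c | ∃ d ∈ p, d ⊓ a ≤ c}
        ⟨⊤, Order.PFilter.top_mem, le_top⟩
        (fun x ⟨d, hd, hx⟩ y ⟨e, he, hy⟩ => ⟨d ⊓ e, Order.PFilter.inf_mem hd he,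
          le_inf ((inf_le_inf_right a inf_le_left).trans hx)
            ((inf_le_inf_right a inf_le_right).trans hy)⟩)
        (fun x y hxy ⟨d, hd, hx⟩ => ⟨d, hd, hx.trans hxy⟩)
      obtain ⟨d, hd, hdb⟩ : b ∈ q := h q (fun d hd => ⟨d, hd, inf_le_left⟩)
        ⟨⊤, Order.PFilter.top_mem, inf_le_right⟩
      exact Order.PFilter.mem_of_le (F := p) (le_imp_iff.2 hdb) hd⟩
  naturality _ _ _ := rfl

/-! ### Dialgebras -/

/-- `(G, T)`-dialgebras: objects `X` with a morphism `G X → T X`. -/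
structure Dialg {C : Type*} {D : Type*} [Category C] [Category D] (G T : C ⥤ D) where
  /-- the underlying object -/
  carrier : C
  /-- the structure map -/
  str : G.obj carrier ⟶ T.obj carrier

/-- Dialgebra morphisms. -/
@[ext]
structure DialgHom {C : Type*} {D : Type*} [Category C] [Category D] {G T : C ⥤ D}
    (X Y : Dialg G T) where
  /-- the underlying morphism -/
  hom : X.carrier ⟶ Y.carrier
  comm : X.str ≫ T.map hom = G.map hom ≫ Y.str

instance {C : Type*} {D : Type*} [Category C] [Category D] (G T : C ⥤ D) :
    Category (Dialg G T) where
  Hom X Y := DialgHom X Y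
  id X := ⟨𝟙 _, by simp⟩
  comp f g := ⟨f.hom ≫ g.hom, by
    rw [Functor.map_comp, Functor.map_comp, ← Category.assoc, f.comm, Category.assoc, g.comm,
      Category.assoc]⟩
  id_comp f := DialgHom.ext (Category.id_comp f.hom)
  comp_id f := DialgHom.ext (Category.comp_id f.hom)
  assoc f g h := DialgHom.ext (Category.assoc f.hom g.hom h.hom)

/-! ### The functor `H` -/

/-- `H X` consists of the up-closed collections of filters of `X`, ordered by inclusion. -/
abbrev HObj (X : IF.{u}) : Type u := {W : Set (Order.PFilter X) // IsUpperSet W}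

instance (X : IF.{u}) : SemilatticeInf (HObj X) :=
  { (inferInstance : PartialOrder (HObj X)) with
    inf := fun W V => ⟨W.1 ∩ V.1, W.2.inter V.2⟩
    inf_le_left := fun _ _ _ h => h.1
    inf_le_right := fun _ _ _ h => h.2
    le_inf := fun _ _ _ h1 h2 _ h => ⟨h1 h, h2 h⟩ }

instance (X : IF.{u}) : OrderTop (HObj X) where
  top := ⟨Set.univ, isUpperSet_univ⟩
  le_top _ _ _ := trivial

/-- The functor `H : IF → MF`, with `H f W = {a' | f⁻¹ a' ∈ W}`. -/
def H : IF.{u} ⥤ SemilatInfCat.{u} where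
  obj X := SemilatInfCat.of (HObj X)
  map {X Y} f :=
    ({ toFun := fun W => ⟨{a' | filterComap f.hom a' ∈ W.1},
          fun _ _ h ha => W.2 (fun _ hx => h hx) ha⟩
       map_inf' := fun _ _ => rfl
       map_top' := rfl } : InfTopHom (HObj X) (HObj Y))
  map_id _ := rfl
  map_comp _ _ := rfl

/-! ### The functor `M` and the natural transformation `ρ` -/

/-- Semilattice terms over the generators `mon a`, `a ∈ A`. -/
inductive MTerm (A : Type u) : Type u
  | top : MTerm A
  | mon : A → MTerm A
  | inf : MTerm A → MTerm A → MTerm A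

/-- The least semilattice preorder on terms with `mon (a ⊓ b) ≤ mon a`. -/
inductive MLe {A : Type u} [ImpSemilattice A] : MTerm A → MTerm A → Prop
  | refl (s) : MLe s s
  | trans {s t r} : MLe s t → MLe t r → MLe s r
  | le_top (s) : MLe s .top
  | inf_left (s t) : MLe (.inf s t) s
  | inf_right (s t) : MLe (.inf s t) t
  | le_inf {s t r} : MLe s t → MLe s r → MLe s (.inf t r)
  | mon_inf (a b : A) : MLe (.mon (a ⊓ b)) (.mon a)

instance mPreorder (A : Type u) [ImpSemilattice A] : Preorder (MTerm A) where
  le := MLe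
  le_refl := MLe.refl
  le_trans _ _ _ := MLe.trans

/-- The free semilattice generated by the `mon a`, `a ∈ A`, modulo `mon (a ⊓ b) ≤ mon a`. -/
abbrev MObj (A : Type u) [ImpSemilattice A] : Type u := Antisymmetrization (MTerm A) (· ≤ ·)

section MObj

variable {A : Type u} [ImpSemilattice A]

/-- The class of a term. -/
def mcls (t : MTerm A) : MObj A := toAntisymmetrization (· ≤ ·) t

/-- The generator `mon a` of `M A`. -/
def mon (a : A) : MObj A := mcls (.mon a)

instance : SemilatticeInf (MObj A) :=
  { (inferInstance : PartialOrder (MObj A)) with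
    inf := Quotient.map₂ MTerm.inf fun _ _ h1 _ _ h2 =>
      ⟨MLe.le_inf ((MLe.inf_left _ _).trans h1.1) ((MLe.inf_right _ _).trans h2.1),
        MLe.le_inf ((MLe.inf_left _ _).trans h1.2) ((MLe.inf_right _ _).trans h2.2)⟩
    inf_le_left := by
      rintro ⟨s⟩ ⟨t⟩
      exact MLe.inf_left s t
    inf_le_right := by
      rintro ⟨s⟩ ⟨t⟩
      exact MLe.inf_right s t
    le_inf := by
      rintro ⟨s⟩ ⟨t⟩ ⟨r⟩ h1 h2
      exact MLe.le_inf h1 h2 }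

instance : OrderTop (MObj A) where
  top := mcls .top
  le_top := by
    rintro ⟨s⟩
    exact MLe.le_top s

/-- The semilattice element denoted by a term, given the values of the generators. -/
def meval {L : Type v} [SemilatticeInf L] [OrderTop L] (g : A → L) : MTerm A → L
  | .top => ⊤
  | .mon a => g a
  | .inf s t => meval g s ⊓ meval g t

theorem meval_mono {L : Type v} [SemilatticeInf L] [OrderTop L] {g : A → L}
    (hg : ∀ a b, g (a ⊓ b) ≤ g a) {s t : MTerm A} (h : MLe s t) : meval g s ≤ meval g t := by
  induction h with
  | refl s => exact le_rfl
  | trans _ _ h1 h2 => exact h1.trans h2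
  | le_top s => exact le_top
  | inf_left s t => exact inf_le_left
  | inf_right s t => exact inf_le_right
  | le_inf _ _ h1 h2 => exact _root_.le_inf h1 h2
  | mon_inf a b => exact hg a b

/-- The semilattice morphism out of `M A` given on generators by `mon a ↦ g a`. -/
def mlift {L : Type v} [SemilatticeInf L] [OrderTop L] (g : A → L)
    (hg : ∀ a b, g (a ⊓ b) ≤ g a) : InfTopHom (MObj A) L where
  toFun := Quotient.lift (meval g) fun _ _ h =>
    le_antisymm (meval_mono hg h.1) (meval_mono hg h.2)
  map_inf' := by
    rintro ⟨s⟩ ⟨t⟩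
    rfl
  map_top' := rfl

theorem mlift_mon {L : Type v} [SemilatticeInf L] [OrderTop L] (g : A → L)
    (hg : ∀ a b, g (a ⊓ b) ≤ g a) (a : A) : mlift g hg (mon a) = g a := rfl

theorem mhom_ext {L : Type v} [SemilatticeInf L] [OrderTop L] {f g : InfTopHom (MObj A) L}
    (h : ∀ a, f (mon a) = g (mon a)) : f = g := by
  apply DFunLike.ext
  rintro ⟨t⟩
  induction t with
  | top => exact (map_top f).trans (map_top g).symm
  | mon a => exact h a
  | inf s t hs ht =>
    exact (map_inf f (mcls s) (mcls t)).trans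
      ((congrArg₂ (· ⊓ ·) hs ht).trans (map_inf g (mcls s) (mcls t)).symm)

theorem mon_inf_le (a b : A) : mon (a ⊓ b) ≤ mon a := MLe.mon_inf a b

end MObj

/-- The semilattice morphism `M f`, given by `mon a ↦ mon (f a)`. -/
def mmap {A B : ISL.{u}} (f : A ⟶ B) : InfTopHom (MObj A) (MObj B) :=
  mlift (fun a => mon (f.hom a)) (fun a b => by
    rw [map_inf]
    exact mon_inf_le _ _)

/-- The functor `M : ISL → SL`. -/
def M : ISL.{u} ⥤ SemilatInfCat.{u} where
  obj A := SemilatInfCat.of (MObj A)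
  map f := mmap f
  map_id A := mhom_ext (f := mmap (𝟙 A)) (g := InfTopHom.id (MObj A)) fun _ => rfl
  map_comp f g := mhom_ext (f := mmap (f ≫ g)) (g := (mmap g).comp (mmap f)) fun _ => rfl

/-- The predicate lifting `λ(a) = {W ∈ H X | a ∈ W}`. -/
def monLift (X : IF.{u}) (a : Order.PFilter X) : Order.PFilter (HObj X) :=
  mkFilter {W | a ∈ W.1} trivial (fun _ h1 _ h2 => ⟨h1, h2⟩) (fun _ _ h hx => h hx)

/-- The components of `ρ`, given by `mon a ↦ {W | a ∈ W}`. -/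
def rhoApp (X : IF.{u}) : InfTopHom (MObj (Order.PFilter X)) (Order.PFilter (HObj X)) :=
  mlift (monLift X) (fun _ _ W h => W.2 inf_le_left h)

/-- The natural transformation `ρ : M F₁ → F H`. -/
def rho : F1.{u} ⋙ M ⟶ H.op ⋙ F where
  app X := rhoApp X.unop
  naturality X Y f := mhom_ext
    (f := (rhoApp Y.unop).comp (mmap (F1.map f)))
    (g := InfTopHom.comp (filterComap (A := HObj Y.unop) (B := HObj X.unop) (H.map f.unop))
      (rhoApp X.unop))
    fun _ => rfl

/-- The adjoint buddy `ρ♭ : H F₂ → F M` of `ρ`: the composition of `η_{H F₂ A}`,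
`F ρ_{F₂ A}` and `F M η_A`. -/
def rhoFlat : F2.{u} ⋙ H ⟶ M.op ⋙ F where
  app A := eta.app (H.obj (F2.obj A)) ≫ F.map (rho.app (op (F2.obj A))).op ≫
    F.map (M.map (etaISL.app A.unop)).op
  naturality A B f := by
    have key : (InfTopHom.comp (filterComap (H.map (F2.map f)))
        (rho.app (op (F2.obj B)) : InfTopHom _ _)).comp (M.map (etaISL.app B.unop)) =
        (InfTopHom.comp (rho.app (op (F2.obj A))) (M.map (etaISL.app A.unop))).comp
          (M.map f.unop) := mhom_ext fun _ => rfl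
    apply DFunLike.ext (F := InfTopHom (HObj (F2.obj A)) (Order.PFilter (MObj B.unop)))
    intro W
    apply SetLike.ext
    intro m
    have := congrArg (fun g : InfTopHom (MObj B.unop) (Order.PFilter (HObj (F2.obj A))) =>
      W ∈ g m) key
    exact Iff.of_eq this

/-! ### The right inverse `τ` -/

/-- `τ_A : F M A → H F₂ A`. A filter `p` of `F₂ A` belongs to `τ_A U` iff it contains a closed
filter `c` such that `mon a ∈ U` for every clopen filter `ã` containing `c`. -/
def tau (A : ISL.{u}) : InfTopHom (Order.PFilter (MObj A)) (HObj (F2.obj (op A))) where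
  toFun U := ⟨{p : Order.PFilter (Order.PFilter A) |
      ∃ c, IsClosedFilter c ∧ c ≤ p ∧ ∀ a : A, c ≤ tilde a → mon a ∈ U},
    fun _ _ h ⟨c, h1, h2, h3⟩ => ⟨c, h1, h2.trans h, h3⟩⟩
  map_inf' U V := by
    apply Subtype.ext
    ext p
    constructor
    · rintro ⟨c, h1, h2, h3⟩
      exact ⟨⟨c, h1, h2, fun a ha => (h3 a ha).1⟩, ⟨c, h1, h2, fun a ha => (h3 a ha).2⟩⟩
    · rintro ⟨⟨c, h1, h2, h3⟩, ⟨d, k1, k2, k3⟩⟩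
      obtain ⟨q, rfl⟩ := isClosedFilter_iff.1 h1
      obtain ⟨r, rfl⟩ := isClosedFilter_iff.1 k1
      refine ⟨Order.PFilter.principal (q ⊓ r), isClosedFilter_iff.2 ⟨_, rfl⟩,
        Order.PFilter.principal_le_iff.2 (Order.PFilter.inf_mem
          (Order.PFilter.principal_le_iff.1 h2) (Order.PFilter.principal_le_iff.1 k2)), ?_⟩
      intro a ha
      have h : q ⊓ r ∈ tilde a := Order.PFilter.principal_le_iff.1 ha
      exact ⟨h3 a (Order.PFilter.principal_le_iff.2 (Order.PFilter.mem_of_le inf_le_left h)),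
        k3 a (Order.PFilter.principal_le_iff.2 (Order.PFilter.mem_of_le inf_le_right h))⟩
  map_top' := by
    apply Subtype.ext
    ext p
    refine iff_of_true ⟨Order.PFilter.principal ⊤, isClosedFilter_iff.2 ⟨_, rfl⟩, ?_, ?_⟩ trivial
    · exact Order.PFilter.principal_le_iff.2 (Order.PFilter.top_mem (F := p))
    · exact fun _ _ => trivial

/-! ### Complex algebras and filter extensions -/

/-- The complex algebra of an `(i, H)`-dialgebra: `F₁ X` with structure map the composition
of `ρ_X` with `F γ`. -/
def complexAlg (X : Dialg i.{u} H) : Dialg M.{u} j :=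
  ⟨F1.obj (op X.carrier), rho.app (op X.carrier) ≫ F.map X.str.op⟩

/-- The filter extension of `(X, γ)`: the I-frame `F₂ F₁ X` with structure map the composition
of `F γ*` with `τ_{F₁ X}`, where `γ*` is the structure map of the complex algebra. -/
def filterExt (X : Dialg i.{u} H) : Dialg i.{u} H :=
  ⟨F2.obj (op (complexAlg X).carrier), F.map (complexAlg X).str.op ≫ tau (complexAlg X).carrier⟩

/-- The map `η_X` from the states of `X` to those of its filter extension. -/
def toFilterExt (X : Dialg i.{u} H) : i.obj X.carrier ⟶ i.obj (filterExt X).carrier :=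
  eta.app (i.obj X.carrier)

/-! ### Formulas, the deductive system and satisfaction -/

/-- Formulas built from `⊤`, `∧`, `→` and the modality. -/
inductive Formula : Type
  | top : Formula
  | and : Formula → Formula → Formula
  | imp : Formula → Formula → Formula
  | mon : Formula → Formula

namespace Formula

/-- Bi-implication. -/
def iff (φ ψ : Formula) : Formula := (φ.imp ψ).and (ψ.imp φ)

end Formula

/-- Theorems of the Hilbert-style system for the meet-implication fragment of intuitionistic
logic, extended with the axiom `mon (φ ∧ ψ) → mon φ` and the congruence rule. -/
inductive Provable : Formula → Prop
  | k (φ ψ) : Provable (.imp φ (.imp ψ φ))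
  | s (φ ψ χ) : Provable (.imp (.imp φ (.imp ψ χ)) (.imp (.imp φ ψ) (.imp φ χ)))
  | and_left (φ ψ) : Provable (.imp (.and φ ψ) φ)
  | and_right (φ ψ) : Provable (.imp (.and φ ψ) ψ)
  | and_intro (φ ψ) : Provable (.imp φ (.imp ψ (.and φ ψ)))
  | top : Provable .top
  | mon_and (φ ψ) : Provable (.imp (.mon (.and φ ψ)) (.mon φ))
  | mp {φ ψ} : Provable φ → Provable (.imp φ ψ) → Provable ψ
  | cong {φ ψ} : Provable (Formula.iff φ ψ) → Provable (Formula.iff (.mon φ) (.mon ψ))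

/-- The filter `{x | a ∈ γ x}` of states of `(X, γ)`. -/
def monPre (X : Dialg i.{u} H) (a : Order.PFilter X.carrier) : Order.PFilter X.carrier :=
  filterComap X.str (monLift X.carrier a)

theorem mem_monPre (X : Dialg i.{u} H) (a : Order.PFilter X.carrier) (x : X.carrier) :
    x ∈ monPre X a ↔ a ∈ (X.str x : HObj X.carrier).1 := Iff.rfl

/-- The filter of states of `(X, γ)` that satisfy a formula; `x` satisfies `mon φ` iff the truth
set of `φ` belongs to `γ x`. -/
def truthSet (X : Dialg i.{u} H) : Formula → Order.PFilter X.carrier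
  | .top => ⊤
  | .and φ ψ => truthSet X φ ⊓ truthSet X ψ
  | .imp φ ψ => truthSet X φ ⇨ truthSet X ψ
  | .mon φ => monPre X (truthSet X φ)

/-- Satisfaction of a formula at a state. -/
def Sat (X : Dialg i.{u} H) (x : X.carrier) (φ : Formula) : Prop := x ∈ truthSet X φ

theorem sat_top (X : Dialg i.{u} H) (x : X.carrier) : Sat X x .top := trivial

theorem sat_and (X : Dialg i.{u} H) (x : X.carrier) (φ ψ : Formula) :
    Sat X x (.and φ ψ) ↔ Sat X x φ ∧ Sat X x ψ := Iff.rfl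

theorem sat_imp (X : Dialg i.{u} H) (x : X.carrier) (φ ψ : Formula) :
    Sat X x (.imp φ ψ) ↔ ∀ y, x ≤ y → Sat X y φ → Sat X y ψ := Iff.rfl

theorem sat_mon (X : Dialg i.{u} H) (x : X.carrier) (φ : Formula) :
    Sat X x (.mon φ) ↔ truthSet X φ ∈ (X.str x : HObj X.carrier).1 := Iff.rfl

/-- Two states are logically equivalent if they satisfy the same formulas. -/
def LogEquiv (X : Dialg i.{u} H) (x y : X.carrier) : Prop := ∀ φ, Sat X x φ ↔ Sat X y φ

/-- Two states are behaviourally equivalent if some dialgebra morphism identifies them. -/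
def BehEquiv (X : Dialg i.{u} H) (x y : X.carrier) : Prop :=
  ∃ (Y : Dialg i.{u} H) (f : X ⟶ Y), f.hom.hom x = f.hom.hom y

/-! ### The Lindenbaum-Tarski algebra, theory maps and expressivity -/

/-- `Ψ`, with the quotient map `cls` sending a formula to its class, is the algebra of formulas
modulo provable equivalence. -/
structure IsLindenbaumTarski (Ψ : Dialg M.{u} j) (cls : Formula → Ψ.carrier) : Prop where
  surj : Function.Surjective cls
  eq_iff : ∀ φ ψ, cls φ = cls ψ ↔ Provable (Formula.iff φ ψ)
  top : cls .top = ⊤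
  and : ∀ φ ψ, cls (.and φ ψ) = cls φ ⊓ cls ψ
  imp : ∀ φ ψ, cls (.imp φ ψ) = cls φ ⇨ cls ψ
  mon : ∀ φ, cls (.mon φ) = Ψ.str (mon (cls φ))

section Theory

variable {Ψ : Dialg M.{u} j} (hΨ : Limits.IsInitial Ψ)

/-- The interpretation of the initial `(M, j)`-dialgebra in `(X, γ)`: the unique
`(M, j)`-dialgebra morphism into the complex algebra. -/
def interpretation (X : Dialg i.{u} H) : Ψ.carrier ⟶ F1.obj (op X.carrier) :=
  (hΨ.to (complexAlg X)).hom

/-- The theory map `i X → i F₂ F₁ X → i F₂ Ψ`. -/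
def theoryMap (X : Dialg i.{u} H) : i.obj X.carrier ⟶ i.obj (F2.obj (op Ψ.carrier)) :=
  eta.app (i.obj X.carrier) ≫ i.map (F2.map (interpretation hΨ X).op)

/-- The theory map factors as a dialgebra morphism followed by a monomorphism of I-frames. -/
def Expressive (X : Dialg i.{u} H) : Prop :=
  ∃ (Y : Dialg i.{u} H) (f : X ⟶ Y) (m : Y.carrier ⟶ F2.obj (op Ψ.carrier)),
    Mono m ∧ theoryMap hΨ X = i.map f.hom ≫ i.map m

/-- The theory map factors as a morphism of M-frames followed by the theory map of an
expressive dialgebra. -/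
def ExpressiveSomewhereElse (X : Dialg i.{u} H) : Prop :=
  ∃ (Y : Dialg i.{u} H) (g : i.obj X.carrier ⟶ i.obj Y.carrier),
    Expressive hΨ Y ∧ theoryMap hΨ X = g ≫ theoryMap hΨ Y

/-- Completeness: the interpretations in all `(i, H)`-dialgebras are jointly monic. -/
def Complete : Prop :=
  ∀ (B : ISL.{u}) (g h : B ⟶ Ψ.carrier),
    (∀ X : Dialg i.{u} H, g ≫ interpretation hΨ X = h ≫ interpretation hΨ X) → g = h

end Theory

end MonMI

open MonMI

namespace MonMI

/-! ### The transformation `τ` -/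

section Tau

/-! By `isClosedFilter_iff`, closed filters of `F A` are exactly the principal ones. So `p ∈ τ_A U`
means that some `q ∈ p` has `mon a ∈ U` for all `a ∈ q`, and every property of `τ` is checked in
this form. The central clause `tilde_mem_tau` makes `τ` a section of `ρ♭`, because a filter of `M A`
is determined by the generators in it.

Through `τ`, each `(M, j)`-dialgebra `B` has a dual `(i, H)`-dialgebra on `F₂ B`. Naturality of `τ`
makes this functorial (`dualDialgMap`), and `tilde_mem_tau` says precisely that `a ↦ ã` is a
dialgebra morphism from `B` to the complex algebra of its dual (`unitDialg`). This unit is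
injective. For initial `Ψ` it is the interpretation in the dual of `Ψ`, so this one model already
gives completeness.

The filter extension of `X` is the dual of its complex algebra. The initial morphism from `Ψ` to
that algebra therefore dualises to a dialgebra morphism from the filter extension to the dual of
`Ψ`. A triangle identity shows that it is the theory map, so expressivity holds with an identity as
monomorphism. Truth of formulas is evaluation in complex algebras, which is preserved by all
morphisms. -/

theorem mem_tau {A : ISL.{u}} {U : Order.PFilter (MObj A)} {p : Order.PFilter (Order.PFilter A)} :
    p ∈ (tau A U).1 ↔ ∃ q ∈ p, ∀ a ∈ q, mon a ∈ U := by
  constructor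
  · rintro ⟨c, hc, hcp, h⟩
    obtain ⟨q, rfl⟩ := isClosedFilter_iff.1 hc
    exact ⟨q, Order.PFilter.principal_le_iff.1 hcp,
      fun a ha => h a (Order.PFilter.principal_le_iff.2 ha)⟩
  · rintro ⟨q, hq, h⟩
    exact ⟨Order.PFilter.principal q, isClosedFilter_iff.2 ⟨q, rfl⟩,
      Order.PFilter.principal_le_iff.2 hq, fun a ha =>
        h a (Order.PFilter.principal_le_iff (x := q) (F := tilde a) |>.1 ha)⟩

/-- The axiom on meets is monotonicity, since `a ≤ b` means `b ⊓ a = a`. -/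
theorem mon_mono {A : Type u} [ImpSemilattice A] {a b : A} (h : a ≤ b) : mon a ≤ mon b := by
  have := mon_inf_le b a
  rwa [inf_eq_right.2 h] at this

theorem tilde_mem_tau {A : ISL.{u}} {U : Order.PFilter (MObj A)} {a : A} :
    tilde a ∈ (tau A U).1 ↔ mon a ∈ U := by
  rw [mem_tau]
  constructor
  · rintro ⟨q, hq, h⟩
    exact h a hq
  · intro h
    -- The smallest filter in `ã` is the principal filter of `a`; by monotonicity it imposes no
    -- condition beyond `mon a ∈ U`.
    exact ⟨Order.PFilter.principal a, Order.PFilter.mem_principal.2 le_rfl, fun b hb =>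
      Order.PFilter.mem_of_le (mon_mono (Order.PFilter.mem_principal.1 hb)) h⟩

/-- A closed filter can serve as its own witness in the definition of `tau`. -/
theorem closed_mem_tau {A : ISL.{u}} {U : Order.PFilter (MObj A)}
    {c : Order.PFilter (Order.PFilter A)} (hc : IsClosedFilter c) :
    c ∈ (tau A U).1 ↔ ∀ d, IsClopenFilter d → c ≤ d → d ∈ (tau A U).1 := by
  constructor
  · intro h d _ hcd
    exact (tau A U).2 hcd h
  · intro h
    exact ⟨c, hc, le_rfl, fun a ha => tilde_mem_tau.1 (h _ ⟨a, rfl⟩ ha)⟩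

theorem mem_tau_iff_exists_closed {A : ISL.{u}} {U : Order.PFilter (MObj A)}
    {p : Order.PFilter (Order.PFilter A)} :
    p ∈ (tau A U).1 ↔ ∃ c, IsClosedFilter c ∧ c ≤ p ∧ c ∈ (tau A U).1 := by
  constructor
  · rintro ⟨c, hc, hcp, h⟩
    exact ⟨c, hc, hcp, c, hc, le_rfl, h⟩
  · rintro ⟨c, _, hcp, h⟩
    exact (tau A U).2 hcp h

/-- The filter generated by the direct image of a filter. -/
def filterMap {A B : Type*} [SemilatticeInf A] [OrderTop A] [SemilatticeInf B] [OrderTop B]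
    (f : InfTopHom A B) (q : Order.PFilter A) : Order.PFilter B :=
  mkFilter {b | ∃ a ∈ q, f a ≤ b} ⟨⊤, Order.PFilter.top_mem, le_top⟩
    (fun x ⟨a, ha, hx⟩ y ⟨b, hb, hy⟩ => ⟨a ⊓ b, Order.PFilter.inf_mem ha hb, by
      rw [map_inf]
      exact inf_le_inf hx hy⟩)
    (fun _ _ h ⟨a, ha, hx⟩ => ⟨a, ha, hx.trans h⟩)

/-- Witnesses are transported in both directions: a filter of `A` to the filter generated by its
image, a filter of `B` to its inverse image. Implications play no role. -/
theorem tau_naturality {A B : ISL.{u}} (f : A ⟶ B) (U : Order.PFilter (MObj B))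
    (p : Order.PFilter (Order.PFilter A)) :
    p ∈ (tau A (filterComap (mmap f) U)).1 ↔ filterComap (filterComap f.hom) p ∈ (tau B U).1 := by
  rw [mem_tau, mem_tau]
  constructor
  · rintro ⟨q, hq, h⟩
    refine ⟨filterMap f.hom q, ?_, ?_⟩
    -- `q` lies below the inverse image of `filterMap f.hom q`, and `p` is up-closed.
    · exact Order.PFilter.mem_of_le (F := p) (x := q) (fun a ha => ⟨a, ha, le_rfl⟩) hq
    · rintro b ⟨a, ha, hb⟩
      exact Order.PFilter.mem_of_le (mon_mono hb) (h a ha)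
  · rintro ⟨r, hr, h⟩
    exact ⟨filterComap f.hom r, hr, fun a ha => h _ ha⟩

/-- The `τ_A` form a natural transformation. -/
def tauNat : M.{u}.op ⋙ F ⟶ F2 ⋙ H where
  app A := tau A.unop
  naturality A B f := by
    apply DFunLike.ext (F := InfTopHom (Order.PFilter (MObj A.unop)) (HObj (F2.obj B)))
    intro U
    apply Subtype.ext
    ext p
    exact tau_naturality f.unop U p

/-- Elements of `M A` are finite meets of generators, and a filter contains a meet iff it contains
both parts. -/
theorem filter_mobj_ext {A : Type u} [ImpSemilattice A] {U V : Order.PFilter (MObj A)}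
    (h : ∀ a : A, mon a ∈ U ↔ mon a ∈ V) : U = V := by
  have inf_mem_iff (W : Order.PFilter (MObj A)) (x y : MObj A) : x ⊓ y ∈ W ↔ x ∈ W ∧ y ∈ W :=
    ⟨fun hW => ⟨Order.PFilter.mem_of_le inf_le_left hW, Order.PFilter.mem_of_le inf_le_right hW⟩,
      fun hW => Order.PFilter.inf_mem hW.1 hW.2⟩
  apply SetLike.ext
  rintro ⟨t⟩
  induction t with
  | top => exact iff_of_true (Order.PFilter.top_mem (F := U)) (Order.PFilter.top_mem (F := V))
  | mon a => exact h a
  | inf s t hs ht =>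
    exact (inf_mem_iff U (mcls s) (mcls t)).trans
      ((and_congr hs ht).trans (inf_mem_iff V (mcls s) (mcls t)).symm)

theorem tauNat_rhoFlat : tauNat.{u} ≫ rhoFlat = 𝟙 (M.{u}.op ⋙ F) := by
  apply NatTrans.ext
  funext A
  apply DFunLike.ext (F := InfTopHom (Order.PFilter (MObj A.unop)) (Order.PFilter (MObj A.unop)))
  intro U
  apply filter_mobj_ext
  intro a
  -- Unfolding the three factors of `ρ♭`, `mon a ∈ ρ♭ W` is by definition `tilde a ∈ W`.
  exact tilde_mem_tau (U := U)

end Tau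

/-! ### Dual dialgebras -/

section Dual

/-- The `(i, H)`-dialgebra `(F₂ A, τ_A ∘ F α)` dual to an `(M, j)`-dialgebra `(A, α)`. -/
def dualDialg (B : Dialg M.{u} j) : Dialg i.{u} H :=
  ⟨F2.obj (op B.carrier), F.map B.str.op ≫ tau B.carrier⟩

/-- Dialgebra morphisms dualise, by naturality of `τ`. -/
def dualDialgMap {B C : Dialg M.{u} j} (h : B ⟶ C) : dualDialg C ⟶ dualDialg B where
  hom := F2.map h.hom.op
  comm := by
    apply DFunLike.ext (F := InfTopHom (Order.PFilter C.carrier) (HObj (F2.obj (op B.carrier))))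
    intro q
    apply Subtype.ext
    ext p
    refine (tau_naturality h.hom (filterComap C.str q) p).symm.trans ?_
    -- The commuting square of `h`, read on inverse images of `q`.
    have key : filterComap (mmap h.hom) (filterComap C.str q) =
        filterComap B.str (filterComap h.hom.hom q) :=
      congrArg (fun g : InfTopHom (MObj B.carrier) C.carrier => filterComap g q) h.comm.symm
    exact Iff.of_eq (congrArg (fun V => p ∈ (tau B.carrier V).1) key)

/-- The unit is a dialgebra morphism from `B` to the complex algebra of its dual. -/
def unitDialg (B : Dialg M.{u} j) : B ⟶ complexAlg (dualDialg B) where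
  hom := etaISL.app B.carrier
  comm := mhom_ext (A := B.carrier) (L := Order.PFilter (Order.PFilter B.carrier))
    (f := InfTopHom.comp tilde B.str)
    (g := InfTopHom.comp (complexAlg (dualDialg B)).str (mmap (etaISL.app B.carrier)))
    -- `p` contains the value of `mon a` iff `mon a` lies in the inverse image of `p` along `B.str`.
    -- The complex algebra instead tests whether `ã` is in `τ` of that inverse image.
    fun a => SetLike.ext (A := Order.PFilter (Order.PFilter B.carrier)) fun p =>
      (tilde_mem_tau (U := filterComap B.str p) (a := a)).symm

/-- The structure map of the complex algebra, as a map on filters of `X`. -/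
def complexStr (X : Dialg i.{u} H) :
    InfTopHom (MObj (Order.PFilter X.carrier)) (Order.PFilter X.carrier) :=
  (complexAlg X).str

/-- Complex algebras are contravariantly functorial. -/
def complexAlgMap {X Y : Dialg i.{u} H} (f : X ⟶ Y) : complexAlg Y ⟶ complexAlg X where
  hom := F1.map f.hom.op
  comm := mhom_ext (A := Order.PFilter Y.carrier) (L := Order.PFilter X.carrier)
    (f := InfTopHom.comp (filterComap f.hom.hom) (complexStr Y))
    (g := InfTopHom.comp (complexStr X) (mmap (F1.map f.hom.op)))
    fun a => SetLike.ext (A := Order.PFilter X.carrier) fun x =>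
      Iff.of_eq (congrArg
        (fun g : InfTopHom X.carrier (HObj Y.carrier) => a ∈ (g x).1) f.comm.symm)

theorem tilde_injective {A : Type*} [SemilatticeInf A] [OrderTop A] :
    Function.Injective (tilde : InfTopHom A (Order.PFilter (Order.PFilter A))) := by
  have le_of_eq_tilde {a b : A} (h : tilde a = tilde b) : b ≤ a := by
    -- Principal filters separate the elements of `A`.
    have hb : Order.PFilter.principal b ∈ tilde b := Order.PFilter.mem_principal.2 le_rfl
    rw [← h] at hb
    exact Order.PFilter.mem_principal.1 hb
  intro a b h
  exact le_antisymm (le_of_eq_tilde h.symm) (le_of_eq_tilde h)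

end Dual

/-! ### Evaluation of formulas in dialgebras -/

section Evaluation

/-- The value of a formula in an `(M, j)`-dialgebra. -/
def evalFormula (B : Dialg M.{u} j) : Formula → B.carrier
  | .top => ⊤
  | .and φ ψ => evalFormula B φ ⊓ evalFormula B ψ
  | .imp φ ψ => evalFormula B φ ⇨ evalFormula B ψ
  | .mon φ => (B.str : InfTopHom (MObj B.carrier) B.carrier) (mon (evalFormula B φ))

theorem dialgHom_mon {B C : Dialg M.{u} j} (f : B ⟶ C) (a : B.carrier) :
    f.hom.hom ((B.str : InfTopHom (MObj B.carrier) B.carrier) (mon a)) =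
      (C.str : InfTopHom (MObj C.carrier) C.carrier) (mon (f.hom.hom a)) :=
  congrArg (fun g : InfTopHom (MObj B.carrier) C.carrier => g (mon a)) f.comm

/-- Applied to `complexAlgMap`, `unitDialg` and initial morphisms, this yields every
truth-preservation result below. -/
theorem map_evalFormula {B C : Dialg M.{u} j} (f : B ⟶ C) (φ : Formula) :
    f.hom.hom (evalFormula B φ) = evalFormula C φ := by
  induction φ with
  | top => exact map_top f.hom.hom
  | and φ ψ h1 h2 => exact (map_inf f.hom.hom _ _).trans (congrArg₂ (· ⊓ ·) h1 h2)
  | imp φ ψ h1 h2 => exact (f.hom.map_himp _ _).trans (congrArg₂ (· ⇨ ·) h1 h2)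
  | mon φ h =>
    exact (dialgHom_mon f _).trans
      (congrArg (fun a => (C.str : InfTopHom (MObj C.carrier) C.carrier) (mon a)) h)

theorem evalFormula_complexAlg (X : Dialg i.{u} H) (φ : Formula) :
    evalFormula (complexAlg X) φ = truthSet X φ := by
  induction φ with
  | top => rfl
  | and φ ψ h1 h2 => exact congrArg₂ (fun a b : Order.PFilter X.carrier => a ⊓ b) h1 h2
  | imp φ ψ h1 h2 => exact congrArg₂ (fun a b : Order.PFilter X.carrier => a ⇨ b) h1 h2
  | mon φ h => exact congrArg (monPre X) h

theorem sat_map_iff {X Y : Dialg i.{u} H} (f : X ⟶ Y) (x : X.carrier) (φ : Formula) :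
    Sat Y (f.hom.hom x) φ ↔ Sat X x φ := by
  have h := map_evalFormula (complexAlgMap f) φ
  rw [evalFormula_complexAlg X, evalFormula_complexAlg Y] at h
  exact Iff.of_eq (congrArg (fun a : Order.PFilter X.carrier => x ∈ a) h)

/-- The truth lemma for the canonical model. No new induction is needed, because the unit carries
the value of `φ` in `B` to its truth set. -/
theorem truthSet_dualDialg (B : Dialg M.{u} j) (φ : Formula) :
    truthSet (dualDialg B) φ = tilde (evalFormula B φ) :=
  (evalFormula_complexAlg (dualDialg B) φ).symm.trans (map_evalFormula (unitDialg B) φ).symm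

/-- `toFilterExt` is only a semilattice morphism, so `sat_map_iff` does not apply. The truth lemma
does: the point `tilde x` satisfies `φ` iff the truth set of `φ` in `X` contains `x`. -/
theorem sat_toFilterExt (X : Dialg i.{u} H) (x : X.carrier) (φ : Formula) :
    Sat (filterExt X) (toFilterExt X x) φ ↔ Sat X x φ := by
  refine (Iff.of_eq (congrArg
    (fun a : Order.PFilter (Order.PFilter (Order.PFilter X.carrier)) =>
      (tilde x : Order.PFilter (Order.PFilter X.carrier)) ∈ a)
    (truthSet_dualDialg (complexAlg X) φ))).trans ?_
  exact Iff.of_eq (congrArg (fun a : Order.PFilter X.carrier => x ∈ a)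
    (evalFormula_complexAlg X φ))

theorem himp_eq_top_iff {A : Type*} [ImpSemilattice A] {a b : A} : a ⇨ b = ⊤ ↔ a ≤ b := by
  rw [← top_le_iff, le_imp_iff, top_inf_eq]

theorem himp_inf_le_right {A : Type*} [ImpSemilattice A] (a b : A) : (a ⇨ b) ⊓ a ≤ b :=
  le_imp_iff.1 le_rfl

theorem evalFormula_iff_eq_top {B : Dialg M.{u} j} {φ ψ : Formula} :
    evalFormula B (Formula.iff φ ψ) = ⊤ ↔ evalFormula B φ = evalFormula B ψ := by
  change (evalFormula B φ ⇨ evalFormula B ψ) ⊓ (evalFormula B ψ ⇨ evalFormula B φ) = ⊤ ↔ _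
  rw [inf_eq_top_iff, himp_eq_top_iff, himp_eq_top_iff]
  exact ⟨fun h => le_antisymm h.1 h.2, fun h => ⟨h.le, h.ge⟩⟩

/-- Algebraic soundness. It gives soundness for all models through complex algebras, and lets
evaluation descend to classes of formulas. -/
theorem evalFormula_eq_top_of_provable (B : Dialg M.{u} j) {φ : Formula} (h : Provable φ) :
    evalFormula B φ = ⊤ := by
  induction h with
  | k φ ψ => exact himp_eq_top_iff.2 (le_imp_iff.2 inf_le_left)
  | s φ ψ χ =>
    refine himp_eq_top_iff.2 (le_imp_iff.2 (le_imp_iff.2 ?_))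
    set a := evalFormula B φ
    set b := evalFormula B ψ
    set c := evalFormula B χ
    change (a ⇨ b ⇨ c) ⊓ (a ⇨ b) ⊓ a ≤ c
    have h1 : (a ⇨ b ⇨ c) ⊓ (a ⇨ b) ⊓ a ≤ b :=
      (inf_le_inf_right a inf_le_right).trans (himp_inf_le_right a b)
    have h2 : (a ⇨ b ⇨ c) ⊓ (a ⇨ b) ⊓ a ≤ b ⇨ c :=
      (inf_le_inf_right a inf_le_left).trans (himp_inf_le_right a (b ⇨ c))
    exact (le_inf h2 h1).trans (himp_inf_le_right b c)
  | and_left φ ψ => exact himp_eq_top_iff.2 inf_le_left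
  | and_right φ ψ => exact himp_eq_top_iff.2 inf_le_right
  | and_intro φ ψ => exact himp_eq_top_iff.2 (le_imp_iff.2 le_rfl)
  | top => rfl
  | mon_and φ ψ =>
    exact himp_eq_top_iff.2 (OrderHomClass.mono (F := InfTopHom (MObj B.carrier) B.carrier)
      B.str (mon_inf_le _ _))
  | @mp φ ψ _ _ h1 h2 => exact top_le_iff.1 (h1 ▸ himp_eq_top_iff.1 h2)
  | cong _ h =>
    exact evalFormula_iff_eq_top.2 (congrArg
      (fun a : B.carrier => (B.str : InfTopHom (MObj B.carrier) B.carrier) (mon a))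
      (evalFormula_iff_eq_top.1 h))

end Evaluation

/-! ### The Lindenbaum-Tarski algebra -/

section LindenbaumTarski

namespace Provable

theorem imp_refl (φ : Formula) : Provable (.imp φ φ) :=
  mp (k φ φ) (mp (k φ (.imp φ φ)) (s φ (.imp φ φ) φ))

theorem weaken {φ : Formula} (ψ : Formula) (h : Provable φ) : Provable (.imp ψ φ) :=
  mp h (k φ ψ)

theorem mp_under {φ ψ χ : Formula} (h1 : Provable (.imp φ ψ))
    (h2 : Provable (.imp φ (.imp ψ χ))) : Provable (.imp φ χ) :=
  mp h1 (mp h2 (s φ ψ χ))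

theorem imp_trans {φ ψ χ : Formula} (h1 : Provable (.imp φ ψ)) (h2 : Provable (.imp ψ χ)) :
    Provable (.imp φ χ) :=
  mp_under h1 (weaken φ h2)

theorem imp_and {φ ψ χ : Formula} (h1 : Provable (.imp φ ψ)) (h2 : Provable (.imp φ χ)) :
    Provable (.imp φ (.and ψ χ)) :=
  mp_under h2 (imp_trans h1 (and_intro ψ χ))

/-- This is residuation in the Lindenbaum-Tarski algebra, and the only form of the deduction theorem
required. -/
theorem imp_imp_iff {φ ψ χ : Formula} :
    Provable (.imp φ (.imp ψ χ)) ↔ Provable (.imp (.and φ ψ) χ) := by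
  constructor
  · intro h
    exact mp_under (and_right φ ψ) (imp_trans (and_left φ ψ) h)
  · intro h
    have h1 : Provable (.imp (.imp ψ (.and φ ψ)) (.imp ψ χ)) := mp (weaken ψ h) (s _ _ _)
    exact imp_trans (and_intro φ ψ) h1

theorem iff_iff {φ ψ : Formula} :
    Provable (Formula.iff φ ψ) ↔ Provable (.imp φ ψ) ∧ Provable (.imp ψ φ) :=
  ⟨fun h => ⟨mp h (and_left _ _), mp h (and_right _ _)⟩, fun h => mp h.2 (mp h.1 (and_intro _ _))⟩

end Provable

instance formulaPreorder : Preorder Formula where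
  le φ ψ := Provable (.imp φ ψ)
  le_refl := Provable.imp_refl
  le_trans _ _ _ := Provable.imp_trans

/-- Formulas modulo provable equivalence. -/
abbrev FormulaClass : Type u := Antisymmetrization (ULift.{u} Formula) (· ≤ ·)

/-- The class of a formula. -/
def formulaCls (φ : Formula) : FormulaClass.{u} := toAntisymmetrization (· ≤ ·) ⟨φ⟩

theorem formulaCls_le {φ ψ : Formula} :
    formulaCls.{u} φ ≤ formulaCls ψ ↔ Provable (.imp φ ψ) := Iff.rfl

theorem formulaCls_surjective : Function.Surjective formulaCls.{u} := by
  rintro ⟨⟨φ⟩⟩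
  exact ⟨φ, rfl⟩

instance : ImpSemilattice FormulaClass.{u} :=
  { (inferInstance : PartialOrder FormulaClass.{u}) with
    inf := Quotient.map₂ (fun φ ψ => ⟨.and φ.down ψ.down⟩) fun _ _ h1 _ _ h2 =>
      ⟨Provable.imp_and (.imp_trans (.and_left _ _) h1.1) (.imp_trans (.and_right _ _) h2.1),
        Provable.imp_and (.imp_trans (.and_left _ _) h1.2) (.imp_trans (.and_right _ _) h2.2)⟩
    inf_le_left := by
      rintro ⟨φ⟩ ⟨ψ⟩
      exact Provable.and_left φ.down ψ.down
    inf_le_right := by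
      rintro ⟨φ⟩ ⟨ψ⟩
      exact Provable.and_right φ.down ψ.down
    le_inf := by
      rintro ⟨φ⟩ ⟨ψ⟩ ⟨χ⟩ h1 h2
      exact Provable.imp_and h1 h2
    top := formulaCls .top
    le_top := by
      rintro ⟨φ⟩
      exact Provable.weaken φ.down Provable.top
    himp := Quotient.map₂ (fun φ ψ => ⟨.imp φ.down ψ.down⟩) fun _ _ h1 _ _ h2 =>
      -- Implication is contravariant in its premise, so the reverse half of the first equivalence
      -- is paired with the forward half of the second.
      ⟨Provable.imp_imp_iff.2 (.imp_trans (.mp_under (.imp_trans (.and_right _ _) h1.2)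
          (.and_left _ _)) h2.1),
        Provable.imp_imp_iff.2 (.imp_trans (.mp_under (.imp_trans (.and_right _ _) h1.1)
          (.and_left _ _)) h2.2)⟩
    le_himp_iff' := by
      rintro ⟨φ⟩ ⟨ψ⟩ ⟨χ⟩
      exact Provable.imp_imp_iff }

/-- The modality on classes of formulas. -/
def formulaClassMon : FormulaClass.{u} → FormulaClass.{u} :=
  Quotient.map (fun φ => ⟨.mon φ.down⟩) fun _ _ h =>
    Provable.iff_iff.1 (.cong (Provable.iff_iff.2 h))

theorem formulaClassMon_inf_le (a b : FormulaClass.{u}) :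
    formulaClassMon (a ⊓ b) ≤ formulaClassMon a := by
  obtain ⟨φ, rfl⟩ := formulaCls_surjective a
  obtain ⟨ψ, rfl⟩ := formulaCls_surjective b
  exact Provable.mon_and φ ψ

/-- The Lindenbaum-Tarski algebra as an `(M, j)`-dialgebra. -/
def lindenbaumTarski : Dialg M.{u} j :=
  ⟨⟨FormulaClass.{u}⟩, mlift formulaClassMon formulaClassMon_inf_le⟩

theorem isLindenbaumTarski : IsLindenbaumTarski lindenbaumTarski.{u} formulaCls where
  surj := formulaCls_surjective
  eq_iff φ ψ := by
    rw [Provable.iff_iff]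
    exact ⟨fun h => ⟨formulaCls_le.{u}.1 h.le, formulaCls_le.{u}.1 h.ge⟩,
      fun h => le_antisymm (formulaCls_le.{u}.2 h.1) (formulaCls_le.{u}.2 h.2)⟩
  top := rfl
  and _ _ := rfl
  imp _ _ := rfl
  mon _ := rfl

theorem evalFormula_lindenbaumTarski (φ : Formula) :
    evalFormula lindenbaumTarski.{u} φ = formulaCls φ := by
  induction φ with
  | top => rfl
  | and φ ψ h1 h2 => exact congrArg₂ (fun a b : FormulaClass.{u} => a ⊓ b) h1 h2
  | imp φ ψ h1 h2 => exact congrArg₂ (fun a b : FormulaClass.{u} => a ⇨ b) h1 h2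
  | mon φ h => exact congrArg formulaClassMon h

theorem evalFormula_eq_of_formulaCls_eq (B : Dialg M.{u} j) {φ ψ : Formula}
    (h : formulaCls.{u} φ = formulaCls ψ) : evalFormula B φ = evalFormula B ψ :=
  evalFormula_iff_eq_top.1 (evalFormula_eq_top_of_provable B
    ((isLindenbaumTarski.eq_iff φ ψ).1 h))

/-- Evaluation of classes of formulas in an `(M, j)`-dialgebra. -/
def evalClass (B : Dialg M.{u} j) : FormulaClass.{u} → B.carrier :=
  Quotient.lift (fun φ => evalFormula B φ.down) fun _ _ h =>
    evalFormula_eq_of_formulaCls_eq B (Quotient.sound h)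

/-- The morphism from the Lindenbaum-Tarski algebra given by evaluation. -/
def evalDialg (B : Dialg M.{u} j) : lindenbaumTarski ⟶ B where
  hom :=
    { hom :=
        { toFun := evalClass B
          map_inf' := by
            rintro ⟨φ⟩ ⟨ψ⟩
            rfl
          map_top' := rfl }
      map_himp := by
        rintro ⟨φ⟩ ⟨ψ⟩
        rfl }
  comm := by
    refine mhom_ext (A := FormulaClass.{u}) (L := B.carrier) ?_
    rintro ⟨φ⟩
    rfl

/-- The Lindenbaum-Tarski algebra is initial. -/
def lindenbaumTarskiIsInitial : Limits.IsInitial lindenbaumTarski.{u} :=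
  Limits.IsInitial.ofUniqueHom evalDialg fun B f => by
    apply DialgHom.ext
    apply ISLHom.ext
    apply DFunLike.ext (F := InfTopHom FormulaClass.{u} B.carrier)
    intro a
    -- Every class is the value of a formula, and morphisms preserve values, so nothing is left to
    -- choose.
    obtain ⟨φ, rfl⟩ := formulaCls_surjective a
    have h := map_evalFormula f φ
    rw [evalFormula_lindenbaumTarski] at h
    exact h

end LindenbaumTarski

/-! ### Completeness and expressivity -/

section Expressivity

theorem provable_of_formulaCls_eq_top {φ : Formula} (h : formulaCls.{u} φ = ⊤) : Provable φ :=
  .mp .top ((Provable.iff_iff.1 ((isLindenbaumTarski.{u}.eq_iff φ .top).1 h)).2)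

/-- For completeness a single state suffices, in the dual of the Lindenbaum-Tarski algebra. -/
theorem provable_iff_valid (φ : Formula) :
    Provable φ ↔ ∀ (X : Dialg i.{u} H) (x : X.carrier), Sat X x φ := by
  constructor
  · intro h X x
    have htop : truthSet X φ = ⊤ :=
      (evalFormula_complexAlg X φ).symm.trans (evalFormula_eq_top_of_provable _ h)
    change x ∈ truthSet X φ
    rw [htop]
    exact mem_top_filter
  · intro h
    -- The least filter contains only `⊤`, so by the truth lemma this state satisfies exactly the
    -- theorems.
    have hsat := h (dualDialg lindenbaumTarski)
      (Order.PFilter.principal (⊤ : FormulaClass.{u}))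
    change _ ∈ truthSet (dualDialg lindenbaumTarski) φ at hsat
    rw [truthSet_dualDialg, evalFormula_lindenbaumTarski] at hsat
    exact provable_of_formulaCls_eq_top.{u} (top_le_iff.1 (Order.PFilter.mem_principal.1 hsat))

variable {Ψ : Dialg M.{u} j} (hΨ : Limits.IsInitial Ψ)

theorem interpretation_eq {X : Dialg i.{u} H} (f : Ψ ⟶ complexAlg X) :
    interpretation hΨ X = f.hom :=
  congrArg DialgHom.hom (hΨ.hom_ext (hΨ.to (complexAlg X)) f)

theorem interpretation_evalFormula (X : Dialg i.{u} H) (φ : Formula) :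
    (interpretation hΨ X).hom (evalFormula Ψ φ) = truthSet X φ :=
  (map_evalFormula (hΨ.to (complexAlg X)) φ).trans (evalFormula_complexAlg X φ)

/-- By initiality the interpretation in `dualDialg Ψ` is the unit, which is injective. -/
theorem complete_of_isInitial : Complete hΨ := by
  intro B g h hgh
  have key := hgh (dualDialg Ψ)
  rw [interpretation_eq hΨ (unitDialg Ψ)] at key
  apply ISLHom.ext
  apply DFunLike.ext (F := InfTopHom B Ψ.carrier)
  intro b
  exact tilde_injective (congrArg (fun f => ISLHom.hom f b) key)

/-- The dual of the interpretation is a dialgebra morphism out of the filter extension. -/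
def filterExtToDual (X : Dialg i.{u} H) : filterExt X ⟶ dualDialg Ψ :=
  dualDialgMap (hΨ.to (complexAlg X))

theorem theoryMap_filterExt (X : Dialg i.{u} H) :
    theoryMap hΨ (filterExt X) = i.map (filterExtToDual hΨ X).hom := by
  -- By initiality, the interpretation in the filter extension is the one in `X` followed by the
  -- unit. The dual of the unit then cancels against `eta` by a triangle identity, which holds
  -- definitionally.
  have h := interpretation_eq hΨ (X := filterExt X)
    (hΨ.to (complexAlg X) ≫ unitDialg (complexAlg X))
  rw [theoryMap, h]
  rfl

theorem expressive_filterExt (X : Dialg i.{u} H) : Expressive hΨ (filterExt X) :=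
  ⟨dualDialg Ψ, filterExtToDual hΨ X, 𝟙 _,
    inferInstanceAs (Mono (𝟙 (F2.obj (op Ψ.carrier)))), theoryMap_filterExt hΨ X⟩

theorem theoryMap_eq_toFilterExt_comp (X : Dialg i.{u} H) :
    theoryMap hΨ X = toFilterExt X ≫ theoryMap hΨ (filterExt X) := by
  rw [theoryMap_filterExt]
  rfl

/-- Logically equivalent states are identified by the theory map. Conversely, dialgebra morphisms
and `toFilterExt` both preserve and reflect truth. -/
theorem logEquiv_iff_behEquiv_filterExt (X : Dialg i.{u} H) (x y : X.carrier) :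
    LogEquiv X x y ↔ BehEquiv (filterExt X) (toFilterExt X x) (toFilterExt X y) := by
  constructor
  · intro h
    -- Over the Lindenbaum-Tarski algebra, this morphism sends the image of a state to the filter of
    -- classes of formulas true at it.
    refine ⟨_, filterExtToDual lindenbaumTarskiIsInitial X, ?_⟩
    apply SetLike.ext (A := Order.PFilter FormulaClass.{u})
    intro a
    obtain ⟨φ, rfl⟩ := formulaCls_surjective a
    have key := interpretation_evalFormula lindenbaumTarskiIsInitial X φ
    rw [evalFormula_lindenbaumTarski] at key
    have mem_iff (z : X.carrier) := Iff.of_eq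
      (congrArg (fun a : Order.PFilter X.carrier => z ∈ a) key)
    exact (mem_iff x).trans ((h φ).trans (mem_iff y).symm)
  · rintro ⟨Y, f, h⟩ φ
    have sat_iff (z : X.carrier) : Sat Y (f.hom.hom (toFilterExt X z)) φ ↔ Sat X z φ :=
      (sat_map_iff f (toFilterExt X z) φ).trans (sat_toFilterExt X z φ)
    exact (sat_iff x).symm.trans ((Iff.of_eq (congrArg (Sat Y · φ) h)).trans (sat_iff y))

end Expressivity

end MonMI

theorem mainTheorem12 :
    -- the transformation `τ` is natural and right inverse to `ρ♭`
    (∃ t : M.{u}.op ⋙ F ⟶ F2 ⋙ H, (∀ A : ISL.{u}, t.app (op A) = tau A) ∧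
      t ≫ rhoFlat = 𝟙 (M.{u}.op ⋙ F)) ∧
    -- the clauses that describe `τ`
    (∀ (A : ISL.{u}) (U : Order.PFilter (MObj A)),
      (∀ a : A, tilde a ∈ (tau A U).1 ↔ mon a ∈ U) ∧
      (∀ c : Order.PFilter (Order.PFilter A), IsClosedFilter c →
        (c ∈ (tau A U).1 ↔ ∀ d, IsClopenFilter d → c ≤ d → d ∈ (tau A U).1)) ∧
      (∀ p : Order.PFilter (Order.PFilter A),
        p ∈ (tau A U).1 ↔ ∃ c, IsClosedFilter c ∧ c ≤ p ∧ c ∈ (tau A U).1)) ∧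
    -- the Lindenbaum-Tarski algebra is initial, and its interpretation is the concrete one
    (∃ (Ψ : Dialg M.{u} j) (cls : Formula → Ψ.carrier) (hΨ : Limits.IsInitial Ψ),
      IsLindenbaumTarski Ψ cls ∧
      ∀ (X : Dialg i.{u} H) (φ : Formula),
        (interpretation hΨ X).hom (cls φ) = truthSet X φ) ∧
    -- completeness, abstractly and for the deductive system
    (∀ (Ψ : Dialg M.{u} j) (hΨ : Limits.IsInitial Ψ), Complete hΨ) ∧
    (∀ φ : Formula, Provable φ ↔ ∀ (X : Dialg i.{u} H) (x : X.carrier), Sat X x φ) ∧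
    -- the concrete description of the structure map of the filter extension
    (∀ (X : Dialg i.{u} H) (p : Order.PFilter (Order.PFilter X.carrier)),
      (∀ a : Order.PFilter X.carrier,
        tilde a ∈ ((filterExt X).str p : HObj (filterExt X).carrier).1 ↔
          monPre X a ∈ p) ∧
      (∀ c : Order.PFilter (Order.PFilter (Order.PFilter X.carrier)), IsClosedFilter c →
        (c ∈ ((filterExt X).str p : HObj (filterExt X).carrier).1 ↔
          ∀ d, IsClopenFilter d → c ≤ d →
            d ∈ ((filterExt X).str p : HObj (filterExt X).carrier).1)) ∧
      (∀ r : Order.PFilter (Order.PFilter (Order.PFilter X.carrier)),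
        r ∈ ((filterExt X).str p : HObj (filterExt X).carrier).1 ↔
          ∃ c, IsClosedFilter c ∧ c ≤ r ∧
            c ∈ ((filterExt X).str p : HObj (filterExt X).carrier).1)) ∧
    -- filter extensions are expressive, and theory maps factor through them
    (∀ (Ψ : Dialg M.{u} j) (hΨ : Limits.IsInitial Ψ) (X : Dialg i.{u} H),
      Expressive hΨ (filterExt X) ∧
      theoryMap hΨ X = toFilterExt X ≫ theoryMap hΨ (filterExt X) ∧
      ExpressiveSomewhereElse hΨ X) ∧
    -- expressivity-somewhere-else for states
    (∀ (X : Dialg i.{u} H) (x y : X.carrier),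
      LogEquiv X x y ↔ BehEquiv (filterExt X) (toFilterExt X x) (toFilterExt X y)) := by
  refine ⟨⟨tauNat, fun _ => rfl, tauNat_rhoFlat⟩,
    fun A U => ⟨fun a => tilde_mem_tau, fun c hc => closed_mem_tau hc,
      fun p => mem_tau_iff_exists_closed⟩,
    ⟨lindenbaumTarski, formulaCls, lindenbaumTarskiIsInitial, isLindenbaumTarski, fun X φ => ?_⟩,
    fun Ψ hΨ => complete_of_isInitial hΨ, provable_iff_valid,
    -- The structure map at `p` is `τ` of the inverse image of `p` under `γ*`, so the clauses for
    -- `τ` specialise to it.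
    fun X p => ⟨fun a => tilde_mem_tau (U := filterComap (complexAlg X).str p),
      fun c hc => closed_mem_tau (U := filterComap (complexAlg X).str p) hc,
      fun r => mem_tau_iff_exists_closed (U := filterComap (complexAlg X).str p)⟩,
    fun Ψ hΨ X => ⟨expressive_filterExt hΨ X, theoryMap_eq_toFilterExt_comp hΨ X,
      filterExt X, toFilterExt X, expressive_filterExt hΨ X,
      theoryMap_eq_toFilterExt_comp hΨ X⟩,
    logEquiv_iff_behEquiv_filterExt⟩
  rw [← evalFormula_lindenbaumTarski]
  exact interpretation_evalFormula lindenbaumTarskiIsInitial X φ
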